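/- Let $p$ be a prime, let $X=\Delta_p$ be the additive topological group of $p$-adic integers, and let $\alpha$ be a topological automorphism of $X$, i.e. $\alpha x=cx$ for a $p$-adic unit $c=\sum_{n\ge 0}c_np^n$ with digits $c_n\in\{0,\dots,p-1\}$, $c_0\neq 0$. Let $m_K$ denote the normalized Haar measure of a compact subgroup $K$ of $X$, regarded as a distribution on $X$, and $E_x$ the distribution concentrated at $x\in X$. A distribution on $X$ is called degenerate if it equals $E_x$ for some $x\in X$, and idempotent if it is of the form $m_K*E_x$ with $K$ a compact subgroup of $X$ and $x\in X$. The following statements hold. 1. Let $\xi_1,\xi_2$ be independent random variables with values in $X$ and distributions $\mu_1,\mu_2$. Assume that the conditional distribution of $L_2=\xi_1+\alpha\xi_2$ given $L_1=\xi_1+\xi_2$ is symmetric (that is, invariant under $x\mapsto -x$ for almost all values of $L_1$). (i) If $p>2$ and $c_0\neq p-1$, then there are a compact subgroup $K$ of $X$ and $x_1,x_2\in X$ such that $\mu_j=m_K*E_{x_j}$, $j=1,2$. If moreover $c_0=1$, then $\mu_1$ and $\mu_2$ are degenerate. (ii) If $p=2$, $c_0=1$ and $c_1=0$, then $\mu_1$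 and $\mu_2$ are degenerate. 2. If either $p>2$ and $c_0=p-1$, or $p=2$ and $c_0=c_1=1$, then there exist independent random variables $\xi_1,\xi_2$ with values in $X$ and distributions $\mu_1,\mu_2$ such that the conditional distribution of $L_2=\xi_1+\alpha\xi_2$ given $L_1=\xi_1+\xi_2$ is symmetric, whereas neither $\mu_1$ nor $\mu_2$ is idempotent. -/

import Mathlib

open MeasureTheory ProbabilityTheory
open scoped MeasureTheory

/-- The `n`-th digit `x_n ∈ {0, …, p - 1}` in the canonical expansion `x = ∑ x_n p ^ n` of a
`p`-adic integer: the residue of `x` modulo `p ^ (n + 1)`, taken in `{0, …, p ^ (n + 1) - 1}`,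
divided by `p ^ n` with the remainder discarded. -/
noncomputable def padicDigit {p : ℕ} [Fact p.Prime] (x : ℤ_[p]) (n : ℕ) : ℕ :=
  (PadicInt.toZModPow (n + 1) x).val / p ^ n

/-- Every topological automorphism of the additive group of `p`-adic integers is the
multiplication by a unique unit. -/
theorem existsUnique_unit_eq_mul {p : ℕ} [Fact p.Prime] (α : ℤ_[p] ≃ₜ+ ℤ_[p]) :
    ∃! c : ℤ_[p]ˣ, ∀ x, α x = c * x := by
  have key : ∀ β : ℤ_[p] ≃ₜ+ ℤ_[p], ∀ x, β x = β 1 * x := by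
    intro β
    have h : (fun x => β x) = fun x => β 1 * x := by
      refine PadicInt.denseRange_natCast.equalizer β.continuous (by fun_prop) ?_
      funext n
      have := map_nsmul β n 1
      simpa [mul_comm] using this
    exact fun x => congrFun h x
  refine ⟨⟨α 1, α.symm 1, ?_, ?_⟩, ?_, ?_⟩
  · rw [← key]; simp
  · rw [mul_comm, ← key]; simp
  · exact key α
  · intro c hc
    ext
    simpa using (hc 1).symm

/-- The conditional distribution of `L₂` given `L₁` under `P` is symmetric: for almost all values
`t` of `L₁` the regular conditional distribution of `L₂` given `L₁ = t` is invariant under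
`x ↦ -x`. -/
def SymmetricCondDistrib {Ω X : Type*} [MeasurableSpace Ω] [MeasurableSpace X]
    [StandardBorelSpace X] [Nonempty X] [InvolutiveNeg X]
    (L₂ L₁ : Ω → X) (P : Measure Ω) [IsFiniteMeasure P] : Prop :=
  ∀ᵐ t ∂(P.map L₁), (condDistrib L₂ L₁ P t).IsNegInvariant

section Distributions

variable {X : Type*} [AddCommGroup X] [TopologicalSpace X] [IsTopologicalAddGroup X]
  [MeasurableSpace X] [BorelSpace X]

/-- The Haar distribution `m_K` of a compact subgroup `K` of `X`: the normalized Haar measure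
of `K`, regarded as a probability distribution on `X`. -/
noncomputable def haarDistribution (K : AddSubgroup X) [CompactSpace K] : Measure X :=
  (Measure.addHaarMeasure (⊤ : TopologicalSpace.PositiveCompacts K)).map ((↑) : K → X)

/-- `μ` is degenerate: it is concentrated at one point. -/
def IsDegenerateDistribution (μ : Measure X) : Prop :=
  ∃ x : X, μ = Measure.dirac x

/-- `μ ∈ I(X)`: `μ` is a shift of the Haar distribution of a compact subgroup of `X`. -/
def IsIdempotentDistribution (μ : Measure X) : Prop :=
  ∃ (K : AddSubgroup X) (_ : CompactSpace K) (x : X),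
    μ = haarDistribution K ∗ Measure.dirac x

end Distributions

/-!
The characters of `ℤ_p` are parametrized by `r ∈ ℚ_p` modulo `ℤ_p`, so a distribution `μ` on `ℤ_p`
has a characteristic function `μ̂` on `ℚ_p`, and symmetry of the conditional distribution becomes
Heyde's equation `μ̂(u + v) ν̂(u + c v) = μ̂(u - v) ν̂(u - c v)`. On the line `u = -c v` it reads
`|μ̂(κ r)| = |μ̂(r)| |ν̂(2 c r / (1 + c))|` with `κ = (1 - c) / (1 + c)`.

* If `|κ| < 1`, some `κ ^ k r` lies in `ℤ_p`. As `|μ̂|` does not increase along `r, κ r, κ² r, …`,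
  this gives `|μ̂| = 1` everywhere, and the same holds for `ν̂`.
* If `κ`, `2` and `1 + c` are units, some power of `κ` fixes `r` modulo `ℤ_p`, so `|μ̂|` is
  constant along the orbit of `r`. Thus `μ̂(r) ≠ 0` forces `|ν̂(2 c r / (1 + c))| = 1`, hence
  `|ν̂(r)| = 1`, and conversely: `μ` and `ν` are shifts of the Haar distribution of the annihilator
  of `{r | μ̂(r) ≠ 0}`.
* If `|1 + c| < |1 - c|`, the half-sum of the Haar distributions of `ℤ_p` and `p ℤ_p` satisfies
  the equation together with itself, but its characteristic function takes the value `1 / 2`.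
-/

open scoped BoundedContinuousFunction

theorem continuous_coe_addChar {X : Type*} [AddCommGroup X] [TopologicalSpace X]
    {χ : AddChar X Circle} (hχ : Continuous χ) : Continuous fun x => (χ x : ℂ) :=
  continuous_induced_dom.comp hχ

section CharFun

variable {X : Type*} [AddCommGroup X] [MeasurableSpace X] {μ : Measure X} {χ : AddChar X Circle}

/-- The characteristic function of a distribution `μ` on an abelian group, evaluated at a unitary
character. -/
noncomputable def addCharFun (μ : Measure X) (χ : AddChar X Circle) : ℂ :=
  ∫ x, (χ x : ℂ) ∂μ

theorem addCharFun_eq_of_ae_eq [IsProbabilityMeasure μ] {z : ℂ} (h : ∀ᵐ x ∂μ, (χ x : ℂ) = z) :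
    addCharFun μ χ = z := by
  rw [addCharFun, integral_congr_ae h]
  simp

theorem addCharFun_inv (μ : Measure X) (χ : AddChar X Circle) :
    addCharFun μ χ⁻¹ = star (addCharFun μ χ) := by
  simp only [addCharFun, Complex.star_def, ← integral_conj, AddChar.inv_apply',
    Circle.coe_inv_eq_conj]

theorem norm_addCharFun_le_one [IsProbabilityMeasure μ] (χ : AddChar X Circle) :
    ‖addCharFun μ χ‖ ≤ 1 := by
  simpa [addCharFun] using norm_integral_le_of_norm_le_const (μ := μ) (C := 1)
    (f := fun x => (χ x : ℂ)) (.of_forall fun x => (Circle.norm_coe _).le)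

theorem exists_ae_eq_of_norm_addCharFun_eq_one [IsProbabilityMeasure μ]
    (h : ‖addCharFun μ χ‖ = 1) : ∃ z, ∀ᵐ x ∂μ, χ x = z := by
  rcases ae_eq_const_or_norm_integral_lt_of_norm_le_const (μ := μ) (f := fun x => (χ x : ℂ))
    (.of_forall fun x => (Circle.norm_coe (χ x)).le) with hconst | hlt
  · obtain ⟨x, hx⟩ := hconst.exists
    refine ⟨χ x, hconst.mono fun y hy => Circle.ext (hy.trans hx.symm)⟩
  · rw [probReal_univ, one_mul] at hlt
    exact absurd h hlt.ne

theorem norm_addCharFun_pow_eq_one [IsProbabilityMeasure μ] (h : ‖addCharFun μ χ‖ = 1) (n : ℕ) :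
    ‖addCharFun μ (χ ^ n)‖ = 1 := by
  obtain ⟨z, hz⟩ := exists_ae_eq_of_norm_addCharFun_eq_one h
  rw [addCharFun_eq_of_ae_eq (z := (z ^ n : Circle)) (hz.mono fun x hx => by simp [hx])]
  exact Circle.norm_coe _

theorem exists_ae_forall_addChar_eq [TopologicalSpace X] [HereditarilyLindelofSpace X]
    [IsProbabilityMeasure μ] :
    ∃ x, ∀ᵐ y ∂μ, ∀ χ : AddChar X Circle, Continuous χ → ‖addCharFun μ χ‖ = 1 → χ y = χ x := by
  obtain ⟨x, hx⟩ := Measure.nonempty_support (NeZero.ne μ)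
  refine ⟨x, ?_⟩
  filter_upwards [Measure.support_mem_ae (μ := μ)] with y hy χ hχ hone
  obtain ⟨z, hz⟩ := exists_ae_eq_of_norm_addCharFun_eq_one hone
  have hsupp : μ.support ⊆ {x | χ x = z} :=
    Measure.support_subset_of_isClosed (isClosed_eq hχ continuous_const) hz
  exact (hsupp hy).trans (hsupp hx).symm

end CharFun

section Product

variable {X : Type*} [AddCommGroup X]

/-- The characters `(x, y) ↦ u x * v y` of `X × X` with `u` and `v` in `Γ`. -/
def prodCharGroup (Γ : Subgroup (AddChar X Circle)) : Subgroup (AddChar (X × X) Circle) where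
  carrier := {χ | ∃ u ∈ Γ, ∃ v ∈ Γ, ∀ x y, χ (x, y) = u x * v y}
  one_mem' := ⟨1, Γ.one_mem, 1, Γ.one_mem, fun x y => by simp⟩
  mul_mem' := fun ⟨u, hu, v, hv, hχ⟩ ⟨u', hu', v', hv', hψ⟩ =>
    ⟨u * u', Γ.mul_mem hu hu', v * v', Γ.mul_mem hv hv', fun x y => by
      simp [hχ, hψ, mul_mul_mul_comm]⟩
  inv_mem' := fun ⟨u, hu, v, hv, hχ⟩ =>
    ⟨u⁻¹, Γ.inv_mem hu, v⁻¹, Γ.inv_mem hv, fun x y => by simp [hχ]⟩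

theorem compAddMonoidHom_fst_mul_snd_mem_prodCharGroup {Γ : Subgroup (AddChar X Circle)}
    {u v : AddChar X Circle} (hu : u ∈ Γ) (hv : v ∈ Γ) :
    u.compAddMonoidHom (AddMonoidHom.fst X X) * v.compAddMonoidHom (AddMonoidHom.snd X X) ∈
      prodCharGroup Γ :=
  ⟨u, hu, v, hv, fun _ _ => rfl⟩

end Product

section Separating

variable {X : Type*} [AddCommGroup X] [TopologicalSpace X]

/-- A group of continuous unitary characters that separates the points of a topological abelian
group. It stands in for the full character group, so that no classification of the characters is
needed. -/
structure IsSeparatingCharGroup (Γ : Subgroup (AddChar X Circle)) : Prop where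
  continuous : ∀ χ ∈ Γ, Continuous χ
  exists_ne_one : ∀ x ≠ 0, ∃ χ ∈ Γ, χ x ≠ 1

namespace IsSeparatingCharGroup

variable {Γ : Subgroup (AddChar X Circle)}

protected theorem prod (hΓ : IsSeparatingCharGroup Γ) :
    IsSeparatingCharGroup (prodCharGroup Γ) where
  continuous := by
    rintro χ ⟨u, hu, v, hv, hχ⟩
    rw [show ⇑χ = fun z => u z.1 * v z.2 from funext fun z => hχ z.1 z.2]
    exact ((hΓ.continuous u hu).comp continuous_fst).mul
      ((hΓ.continuous v hv).comp continuous_snd)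
  exists_ne_one := by
    rintro ⟨x, y⟩ hxy
    by_cases hx : x = 0
    · obtain ⟨v, hv, hne⟩ := hΓ.exists_ne_one y fun hy => hxy (Prod.ext hx hy)
      exact ⟨_, compAddMonoidHom_fst_mul_snd_mem_prodCharGroup Γ.one_mem hv, by simpa⟩
    · obtain ⟨u, hu, hne⟩ := hΓ.exists_ne_one x hx
      exact ⟨_, compAddMonoidHom_fst_mul_snd_mem_prodCharGroup hu Γ.one_mem, by simpa⟩

/-- The members of `Γ`, viewed as bounded continuous complex functions. -/
def boundedFunctions (Γ : Subgroup (AddChar X Circle)) : Submonoid (X →ᵇ ℂ) where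
  carrier := {f | ∃ χ ∈ Γ, ∀ x, f x = χ x}
  one_mem' := ⟨1, Γ.one_mem, fun _ => by simp⟩
  mul_mem' := fun ⟨χ, hχ, hf⟩ ⟨ψ, hψ, hg⟩ => ⟨χ * ψ, Γ.mul_mem hχ hψ, fun x => by simp [hf, hg]⟩

theorem star_mem_boundedFunctions {f : X →ᵇ ℂ} (hf : f ∈ boundedFunctions Γ) :
    star f ∈ boundedFunctions Γ := by
  obtain ⟨χ, hχ, hf⟩ := hf
  refine ⟨χ⁻¹, Γ.inv_mem hχ, fun x => ?_⟩
  rw [BoundedContinuousFunction.star_apply, hf, AddChar.inv_apply', Circle.coe_inv_eq_conj]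
  rfl

theorem exists_mem_boundedFunctions_ne (hΓ : IsSeparatingCharGroup Γ) {x y : X} (hxy : x ≠ y) :
    ∃ f ∈ boundedFunctions Γ, f x ≠ f y := by
  obtain ⟨χ, hχ, hne⟩ := hΓ.exists_ne_one (x - y) (sub_ne_zero.2 hxy)
  refine ⟨.ofNormedAddCommGroup _ (continuous_coe_addChar (hΓ.continuous χ hχ)) 1
    fun _ => (Circle.norm_coe _).le,
    ⟨χ, hχ, fun _ => rfl⟩, fun heq => hne ?_⟩
  rw [AddChar.map_sub_eq_div, div_eq_one]
  exact Circle.ext heq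

theorem mem_span_boundedFunctions {f : X →ᵇ ℂ}
    (hf : f ∈ StarAlgebra.adjoin ℂ (boundedFunctions Γ : Set (X →ᵇ ℂ))) :
    f ∈ Submodule.span ℂ (boundedFunctions Γ : Set (X →ᵇ ℂ)) := by
  have hstar : star (boundedFunctions Γ : Set (X →ᵇ ℂ)) ⊆ boundedFunctions Γ := fun g hg =>
    star_star g ▸ star_mem_boundedFunctions hg
  have hspan := StarAlgebra.adjoin_eq_span (R := ℂ) (boundedFunctions Γ : Set (X →ᵇ ℂ))
  rw [Set.union_eq_self_of_subset_right hstar, Submonoid.closure_eq] at hspan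
  exact hspan ▸ hf

variable [PolishSpace X] [MeasurableSpace X] [BorelSpace X] {μ ν : Measure X}

theorem ext_of_addCharFun_eq [IsFiniteMeasure μ] [IsFiniteMeasure ν]
    (hΓ : IsSeparatingCharGroup Γ) (h : ∀ χ ∈ Γ, addCharFun μ χ = addCharFun ν χ) : μ = ν := by
  refine ext_of_forall_mem_subalgebra_integral_eq_of_polish
    (A := StarAlgebra.adjoin ℂ (boundedFunctions Γ : Set (X →ᵇ ℂ))) (fun x y hxy => ?_)
    fun f hf => ?_
  · obtain ⟨f, hf, hne⟩ := hΓ.exists_mem_boundedFunctions_ne hxy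
    exact ⟨f, ⟨f.toContinuousMap, ⟨f, StarAlgebra.subset_adjoin ℂ _ hf, rfl⟩, rfl⟩, hne⟩
  · replace hf := mem_span_boundedFunctions hf
    induction hf using Submodule.span_induction with
    | mem f hf =>
      obtain ⟨χ, hχ, hf⟩ := hf
      simpa only [hf, addCharFun] using h χ hχ
    | zero => simp
    | add f g _ _ hf hg =>
      simp only [BoundedContinuousFunction.coe_add, Pi.add_apply]
      rw [integral_add (f.integrable _) (g.integrable _),
        integral_add (f.integrable _) (g.integrable _), hf, hg]
    | smul a f _ hf =>
      simp only [BoundedContinuousFunction.coe_smul, integral_smul, hf]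

theorem isDegenerateDistribution [IsProbabilityMeasure μ] (hΓ : IsSeparatingCharGroup Γ)
    (h : ∀ χ ∈ Γ, ‖addCharFun μ χ‖ = 1) : IsDegenerateDistribution μ := by
  obtain ⟨x, hx⟩ := exists_ae_forall_addChar_eq (μ := μ)
  refine ⟨x, hΓ.ext_of_addCharFun_eq fun χ hχ => ?_⟩
  rw [addCharFun_eq_of_ae_eq (z := (χ x : ℂ))
    (hx.mono fun y hy => congrArg _ (hy χ (hΓ.continuous χ hχ) (h χ hχ)))]
  simp [addCharFun]

end IsSeparatingCharGroup

end Separating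

section Haar

instance isProbabilityMeasure_addHaarMeasure_top {G : Type*} [AddGroup G] [TopologicalSpace G]
    [IsTopologicalAddGroup G] [MeasurableSpace G] [BorelSpace G] [CompactSpace G] [Nonempty G] :
    IsProbabilityMeasure
      (Measure.addHaarMeasure (⊤ : TopologicalSpace.PositiveCompacts G)) :=
  ⟨by simpa using Measure.addHaarMeasure_self (K₀ := (⊤ : TopologicalSpace.PositiveCompacts G))⟩

theorem addCharFun_eq_zero_of_isAddLeftInvariant {G : Type*} [AddCommGroup G] [MeasurableSpace G]
    [MeasurableAdd G] {m : Measure G} [m.IsAddLeftInvariant] {χ : AddChar G Circle} {g : G}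
    (hg : χ g ≠ 1) : addCharFun m χ = 0 := by
  have hinv : addCharFun m χ = χ g * addCharFun m χ := by
    rw [addCharFun, ← integral_const_mul, ← integral_add_left_eq_self _ g]
    simp only [AddChar.map_add_eq_mul, Circle.coe_mul]
  by_contra hne
  exact hg (Circle.ext (mul_right_cancel₀ hne (by simpa using hinv.symm)))

variable {X : Type*} [AddCommGroup X] [TopologicalSpace X] [IsTopologicalAddGroup X]
  [MeasurableSpace X] [BorelSpace X] {μ ν : Measure X} {χ : AddChar X Circle}

theorem addCharFun_conv_dirac [SecondCountableTopology X] [SFinite μ] (hχ : Continuous χ) (x : X) :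
    addCharFun (μ ∗ Measure.dirac x) χ = addCharFun μ χ * χ x := by
  rw [Measure.conv_dirac, addCharFun, integral_map (by fun_prop)
    (continuous_coe_addChar hχ).aestronglyMeasurable, addCharFun, ← integral_mul_const]
  simp only [AddChar.map_add_eq_mul, Circle.coe_mul]

section HaarDistribution

variable (K : AddSubgroup X) [CompactSpace K]

instance isProbabilityMeasure_haarDistribution : IsProbabilityMeasure (haarDistribution K) :=
  Measure.isProbabilityMeasure_map measurable_subtype_coe.aemeasurable

theorem addCharFun_haarDistribution (hχ : Continuous χ) :
    addCharFun (haarDistribution K) χ =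
      addCharFun (Measure.addHaarMeasure (⊤ : TopologicalSpace.PositiveCompacts K))
        (χ.compAddMonoidHom K.subtype) :=
  integral_map measurable_subtype_coe.aemeasurable
    (continuous_coe_addChar hχ).aestronglyMeasurable

theorem addCharFun_haarDistribution_eq_one (hχ : Continuous χ) (h : ∀ k ∈ K, χ k = 1) :
    addCharFun (haarDistribution K) χ = 1 := by
  rw [addCharFun_haarDistribution K hχ]
  exact addCharFun_eq_of_ae_eq (.of_forall fun k => by simp [h k k.2])

theorem addCharFun_haarDistribution_eq_zero (hχ : Continuous χ) (h : ∃ k ∈ K, χ k ≠ 1) :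
    addCharFun (haarDistribution K) χ = 0 := by
  obtain ⟨k, hk, hne⟩ := h
  rw [addCharFun_haarDistribution K hχ]
  exact addCharFun_eq_zero_of_isAddLeftInvariant (g := ⟨k, hk⟩) hne

end HaarDistribution

theorem IsIdempotentDistribution.addCharFun_eq_zero_or_norm_eq_one [SecondCountableTopology X]
    (h : IsIdempotentDistribution μ) (hχ : Continuous χ) :
    addCharFun μ χ = 0 ∨ ‖addCharFun μ χ‖ = 1 := by
  obtain ⟨K, _, x, rfl⟩ := h
  rw [addCharFun_conv_dirac hχ]
  by_cases hK : ∀ k ∈ K, χ k = 1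
  · rw [addCharFun_haarDistribution_eq_one K hχ hK, one_mul]
    exact .inr (Circle.norm_coe _)
  · simp [addCharFun_haarDistribution_eq_zero K hχ (by simpa using hK)]

variable [PolishSpace X] [IsProbabilityMeasure μ] {Γ : Subgroup (AddChar X Circle)}

theorem IsSeparatingCharGroup.eq_haarDistribution_conv_dirac (hΓ : IsSeparatingCharGroup Γ)
    {K : AddSubgroup X} [CompactSpace K] {x : X} (hμ : ∀ᵐ y ∂μ, y - x ∈ K)
    (hzero : ∀ χ ∈ Γ, (∃ k ∈ K, χ k ≠ 1) → addCharFun μ χ = 0) :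
    μ = haarDistribution K ∗ Measure.dirac x := by
  refine hΓ.ext_of_addCharFun_eq fun χ hχ => ?_
  rw [addCharFun_conv_dirac (hΓ.continuous χ hχ)]
  by_cases hK : ∃ k ∈ K, χ k ≠ 1
  · rw [hzero χ hχ hK, addCharFun_haarDistribution_eq_zero K (hΓ.continuous χ hχ) hK, zero_mul]
  · push Not at hK
    rw [addCharFun_haarDistribution_eq_one K (hΓ.continuous χ hχ) hK, one_mul]
    refine addCharFun_eq_of_ae_eq (hμ.mono fun y hy => ?_)
    rw [← sub_add_cancel y x, AddChar.map_add_eq_mul, hK _ hy, one_mul]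

/-- The annihilator of a set of characters of `X`. -/
def charAnnihilator {X : Type*} [AddCommGroup X] (S : Set (AddChar X Circle)) : AddSubgroup X where
  carrier := {x | ∀ χ ∈ S, χ x = 1}
  zero_mem' χ _ := χ.map_zero_eq_one
  add_mem' hx hy χ hχ := by rw [AddChar.map_add_eq_mul, hx χ hχ, hy χ hχ, one_mul]
  neg_mem' hx χ hχ := by rw [AddChar.map_neg_eq_inv, hx χ hχ, inv_one]

theorem isClosed_charAnnihilator {X : Type*} [AddCommGroup X] [TopologicalSpace X]
    {S : Set (AddChar X Circle)} (hS : ∀ χ ∈ S, Continuous χ) :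
    IsClosed (charAnnihilator S : Set X) := by
  have : (charAnnihilator S : Set X) = ⋂ χ ∈ S, {x | χ x = 1} := by
    ext x
    simp [charAnnihilator]
  rw [this]
  exact isClosed_biInter fun χ hχ => isClosed_eq (hS χ hχ) continuous_const

theorem IsSeparatingCharGroup.exists_eq_haarDistribution_conv_dirac (hΓ : IsSeparatingCharGroup Γ)
    {S : Set (AddChar X Circle)} [CompactSpace (charAnnihilator S)] (hS : ∀ χ ∈ S, χ ∈ Γ)
    (hone : ∀ χ ∈ S, ‖addCharFun μ χ‖ = 1) (hzero : ∀ χ ∈ Γ, χ ∉ S → addCharFun μ χ = 0) :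
    ∃ x, μ = haarDistribution (charAnnihilator S) ∗ Measure.dirac x := by
  obtain ⟨x, hx⟩ := exists_ae_forall_addChar_eq (μ := μ)
  refine ⟨x, hΓ.eq_haarDistribution_conv_dirac (hx.mono fun y hy χ hχ => ?_) ?_⟩
  · rw [AddChar.map_sub_eq_div, hy χ (hΓ.continuous χ (hS χ hχ)) (hone χ hχ), div_self']
  · rintro χ hχ ⟨k, hk, hne⟩
    exact hzero χ hχ fun hχS => hne (hk χ hχS)

theorem IsSeparatingCharGroup.exists_haarDistribution_of_norm_eq_one [CompactSpace X]
    [IsProbabilityMeasure ν] (hΓ : IsSeparatingCharGroup Γ)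
    (hμν : ∀ χ ∈ Γ, addCharFun μ χ ≠ 0 → ‖addCharFun ν χ‖ = 1)
    (hνμ : ∀ χ ∈ Γ, addCharFun ν χ ≠ 0 → ‖addCharFun μ χ‖ = 1) :
    ∃ (K : AddSubgroup X) (_ : CompactSpace K) (x₁ x₂ : X),
      μ = haarDistribution K ∗ Measure.dirac x₁ ∧ ν = haarDistribution K ∗ Measure.dirac x₂ := by
  let S := {χ ∈ (Γ : Set (AddChar X Circle)) | addCharFun μ χ ≠ 0}
  have hS : ∀ χ ∈ S, χ ∈ Γ := fun χ hχ => hχ.1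
  have hK : CompactSpace (charAnnihilator S) := isCompact_iff_compactSpace.1
    (isClosed_charAnnihilator fun χ hχ => hΓ.continuous χ (hS χ hχ)).isCompact
  have hone : ∀ χ ∈ S, ‖addCharFun ν χ‖ = 1 := fun χ hχ => hμν χ hχ.1 hχ.2
  obtain ⟨x₁, hx₁⟩ := hΓ.exists_eq_haarDistribution_conv_dirac hS
    (fun χ hχ => hνμ χ hχ.1 (norm_ne_zero_iff.1 (hone χ hχ ▸ one_ne_zero)))
    (fun χ hχ hχS => not_not.1 fun h0 => hχS ⟨hχ, h0⟩)
  obtain ⟨x₂, hx₂⟩ := hΓ.exists_eq_haarDistribution_conv_dirac hS hone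
    (fun χ hχ hχS => not_not.1 fun h0 =>
      hχS ⟨hχ, norm_ne_zero_iff.1 (hνμ χ hχ h0 ▸ one_ne_zero)⟩)
  exact ⟨_, hK, x₁, x₂, hx₁, hx₂⟩

end Haar

section Heyde

theorem symmetricCondDistrib_iff_map_eq {Ω X : Type*} [MeasurableSpace Ω] [MeasurableSpace X]
    [StandardBorelSpace X] [Nonempty X] [InvolutiveNeg X] [MeasurableNeg X]
    {L₂ L₁ : Ω → X} {P : Measure Ω} [IsFiniteMeasure P] (h₂ : Measurable L₂) :
    SymmetricCondDistrib L₂ L₁ P ↔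
      P.map (fun ω => (L₁ ω, L₂ ω)) = P.map (fun ω => (L₁ ω, -L₂ ω)) := by
  have hneg : Measurable (Neg.neg : X → X) := measurable_neg
  have hcomp := condDistrib_comp (mβ := inferInstance) L₁ (μ := P) h₂.aemeasurable hneg
  have hcompProd : P.map L₁ ⊗ₘ (condDistrib L₂ L₁ P).map Neg.neg =
      P.map (fun ω => (L₁ ω, -L₂ ω)) := by
    rw [← Measure.compProd_congr hcomp, compProd_map_condDistrib (hneg.comp h₂).aemeasurable]
    rfl
  rw [← hcompProd, ← condDistrib_ae_eq_iff_measure_eq_compProd L₁ h₂.aemeasurable]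
  refine Filter.eventually_congr (.of_forall fun t => ?_)
  rw [Kernel.map_apply _ hneg]
  exact ⟨fun h => h.neg_eq_self.symm, fun h => ⟨h.symm⟩⟩

variable {X Ω : Type*} [AddCommGroup X] [TopologicalSpace X] [MeasurableSpace X] [BorelSpace X]
  {Γ : Subgroup (AddChar X Circle)} [MeasurableSpace Ω] {P : Measure Ω} {ξ₁ ξ₂ : Ω → X}

theorem IsSeparatingCharGroup.map_prodMk_eq_iff [PolishSpace X] [IsFiniteMeasure P]
    (hΓ : IsSeparatingCharGroup Γ) {ξ η ξ' η' : Ω → X} (hξ : Measurable ξ)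
    (hη : Measurable η) (hξ' : Measurable ξ') (hη' : Measurable η') :
    P.map (fun ω => (ξ ω, η ω)) = P.map (fun ω => (ξ' ω, η' ω)) ↔
      ∀ u ∈ Γ, ∀ v ∈ Γ, ∫ ω, (u (ξ ω) * v (η ω) : ℂ) ∂P = ∫ ω, (u (ξ' ω) * v (η' ω) : ℂ) ∂P := by
  have hmap : ∀ {χ : AddChar (X × X) Circle} (_ : χ ∈ prodCharGroup Γ) {ξ η : Ω → X}
      (_ : Measurable ξ) (_ : Measurable η),
      addCharFun (P.map fun ω => (ξ ω, η ω)) χ = ∫ ω, (χ (ξ ω, η ω) : ℂ) ∂P :=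
    fun hχ _ _ hξ hη => integral_map (hξ.prodMk hη).aemeasurable
      (continuous_coe_addChar (hΓ.prod.continuous _ hχ)).aestronglyMeasurable
  constructor
  · intro heq u hu v hv
    have hχ := compAddMonoidHom_fst_mul_snd_mem_prodCharGroup hu hv
    simpa using (hmap hχ hξ hη).symm.trans (heq ▸ hmap hχ hξ' hη')
  · refine fun h => hΓ.prod.ext_of_addCharFun_eq fun χ hχ => ?_
    rw [hmap hχ hξ hη, hmap hχ hξ' hη']
    obtain ⟨u, hu, v, hv, hχ⟩ := hχ
    simpa [hχ] using h u hu v hv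

theorem integral_addChar_mul_addChar_of_indepFun (h₁ : Measurable ξ₁) (h₂ : Measurable ξ₂)
    (hind : IndepFun ξ₁ ξ₂ P) {χ ψ : AddChar X Circle} (hχ : Continuous χ) (hψ : Continuous ψ) :
    ∫ ω, (χ (ξ₁ ω) * ψ (ξ₂ ω) : ℂ) ∂P = addCharFun (P.map ξ₁) χ * addCharFun (P.map ξ₂) ψ := by
  have hχ' : Continuous fun x => (χ x : ℂ) := continuous_coe_addChar hχ
  have hψ' : Continuous fun x => (ψ x : ℂ) := continuous_coe_addChar hψ
  rw [addCharFun, addCharFun, integral_map h₁.aemeasurable hχ'.aestronglyMeasurable,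
    integral_map h₂.aemeasurable hψ'.aestronglyMeasurable]
  exact hind.integral_fun_comp_mul_comp h₁.aemeasurable h₂.aemeasurable
    hχ'.aestronglyMeasurable hψ'.aestronglyMeasurable

theorem IsSeparatingCharGroup.symmetricCondDistrib_iff [IsTopologicalAddGroup X]
    [PolishSpace X] [IsFiniteMeasure P] (hΓ : IsSeparatingCharGroup Γ) (h₁ : Measurable ξ₁)
    (h₂ : Measurable ξ₂) (hind : IndepFun ξ₁ ξ₂ P) {α : X →+ X} (hα : Continuous α) :
    SymmetricCondDistrib (fun ω => ξ₁ ω + α (ξ₂ ω)) (fun ω => ξ₁ ω + ξ₂ ω) P ↔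
      ∀ u ∈ Γ, ∀ v ∈ Γ,
        addCharFun (P.map ξ₁) (u * v) * addCharFun (P.map ξ₂) (u * v.compAddMonoidHom α) =
          addCharFun (P.map ξ₁) (u / v) * addCharFun (P.map ξ₂) (u / v.compAddMonoidHom α) := by
  have hL₁ : Measurable fun ω => ξ₁ ω + ξ₂ ω := h₁.add h₂
  have hL₂ : Measurable fun ω => ξ₁ ω + α (ξ₂ ω) := h₁.add (hα.measurable.comp h₂)
  have hL₂' : Measurable fun ω => -(ξ₁ ω + α (ξ₂ ω)) := hL₂.neg
  rw [symmetricCondDistrib_iff_map_eq hL₂, hΓ.map_prodMk_eq_iff hL₁ hL₂ hL₁ hL₂']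
  refine forall₄_congr fun u hu v hv => ?_
  replace hu := hΓ.continuous u hu
  replace hv := hΓ.continuous v hv
  rw [← integral_addChar_mul_addChar_of_indepFun h₁ h₂ hind (χ := u * v) (hu.mul hv)
      (ψ := u * v.compAddMonoidHom α) (hu.mul (hv.comp hα)),
    ← integral_addChar_mul_addChar_of_indepFun h₁ h₂ hind (χ := u / v)
      (hu.mul (hv.comp continuous_neg))
      (ψ := u / v.compAddMonoidHom α) (hu.mul ((hv.comp hα).comp continuous_neg))]
  simp only [AddChar.mul_apply, AddChar.div_apply', AddChar.compAddMonoidHom_apply,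
    AddChar.map_add_eq_mul, AddChar.map_neg_eq_inv, Circle.coe_mul, Circle.coe_div, Circle.coe_inv]
  refine Iff.of_eq ?_
  congr 3 <;> · funext ω; ring

end Heyde

section PadicChar

theorem exists_addChar_circle_apply_ne_one {A : Type*} [AddCommGroup A] {a : A} (ha : a ≠ 0) :
    ∃ ψ : AddChar A Circle, ψ a ≠ 1 := by
  obtain ⟨f, hf⟩ := CharacterModule.exists_character_apply_ne_zero_of_ne_zero ha
  have hle : AddSubgroup.zmultiples (1 : ℚ) ≤
      (AddSubgroup.zmultiples (1 : ℝ)).comap (Rat.castHom ℝ).toAddMonoidHom := by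
    simp [AddSubgroup.zmultiples_le, AddSubgroup.mem_comap]
  let ι : AddCircle (1 : ℚ) →+ AddCircle (1 : ℝ) := QuotientAddGroup.map _ _ _ hle
  have hι : Function.Injective ι := by
    refine (injective_iff_map_eq_zero ι).2 fun x hx => ?_
    obtain ⟨q, rfl⟩ := QuotientAddGroup.mk_surjective x
    obtain ⟨n, hn⟩ := (AddCircle.coe_eq_zero_iff (x := (q : ℝ)) 1).1 hx
    refine (AddCircle.coe_eq_zero_iff 1).2 ⟨n, ?_⟩
    simp only [zsmul_eq_mul, mul_one] at hn ⊢
    exact_mod_cast hn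
  refine ⟨AddCircle.toCircle_addChar.compAddMonoidHom (ι.comp f), fun h => hf (hι ?_)⟩
  rw [map_zero]
  exact AddCircle.injective_toCircle one_ne_zero (h.trans AddCircle.toCircle_zero.symm)

variable (p : ℕ) [Fact p.Prime]

theorem exists_addChar_padic :
    ∃ ψ : AddChar ℚ_[p] Circle, (∀ x, ‖x‖ ≤ 1 → ψ x = 1) ∧ ψ (p : ℚ_[p])⁻¹ ≠ 1 := by
  let Z := (PadicInt.subring p).toAddSubgroup
  have hp : (QuotientAddGroup.mk (p : ℚ_[p])⁻¹ : ℚ_[p] ⧸ Z) ≠ 0 := by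
    rw [Ne, QuotientAddGroup.eq_zero_iff]
    change ¬ ‖(p : ℚ_[p])⁻¹‖ ≤ 1
    simpa using (Fact.out : p.Prime).one_lt
  obtain ⟨ψ, hψ⟩ := exists_addChar_circle_apply_ne_one hp
  refine ⟨ψ.compAddMonoidHom (QuotientAddGroup.mk' Z), fun x hx => ?_, hψ⟩
  have hx : (x : ℚ_[p] ⧸ Z) = 0 := (QuotientAddGroup.eq_zero_iff x).2 hx
  simp [hx]

/-- A unitary character of the additive group `ℚ_p` that is trivial on `ℤ_p` but not on
`p⁻¹ ℤ_p`. No other property is needed, so we choose one instead of fixing `exp (2πi {x}_p)`. -/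
noncomputable def padicChar : AddChar ℚ_[p] Circle := (exists_addChar_padic p).choose

/-- The character `x ↦ padicChar (r * x)` of `ℤ_p`; this identifies the character group of `ℤ_p`
with `ℚ_p / ℤ_p`. -/
noncomputable def padicIntChar : AddChar ℚ_[p] (AddChar ℤ_[p] Circle) where
  toFun r := ((padicChar p).mulShift r).compAddMonoidHom PadicInt.Coe.ringHom.toAddMonoidHom
  map_zero_eq_one' := by
    ext x
    simp
  map_add_eq_mul' r s := by
    ext x
    simp [AddChar.mulShift_apply, add_mul, AddChar.map_add_eq_mul]

/-- The characters `padicIntChar r` of `ℤ_p`. -/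
noncomputable def padicIntCharGroup : Subgroup (AddChar ℤ_[p] Circle) :=
  (padicIntChar p).toMonoidHom.range

variable {p}

theorem padicChar_eq_one {x : ℚ_[p]} (hx : ‖x‖ ≤ 1) : padicChar p x = 1 :=
  (exists_addChar_padic p).choose_spec.1 x hx

theorem padicChar_inv_p_ne_one : padicChar p (p : ℚ_[p])⁻¹ ≠ 1 :=
  (exists_addChar_padic p).choose_spec.2

theorem padicIntChar_apply (r : ℚ_[p]) (x : ℤ_[p]) : padicIntChar p r x = padicChar p (r * x) :=
  rfl

theorem padicIntChar_eq_one {r : ℚ_[p]} (hr : ‖r‖ ≤ 1) : padicIntChar p r = 1 := by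
  ext x
  rw [padicIntChar_apply, padicChar_eq_one, AddChar.one_apply]
  rw [norm_mul]
  exact mul_le_one₀ hr (norm_nonneg _) x.norm_le_one

theorem exists_padicIntChar_ne_one {r : ℚ_[p]} (hr : 1 < ‖r‖) :
    ∃ x : ℤ_[p], padicIntChar p r x ≠ 1 := by
  have hr0 : r ≠ 0 := norm_pos_iff.1 (one_pos.trans hr)
  have hlt : ‖r⁻¹‖ < 1 := by rw [norm_inv]; exact inv_lt_one_of_one_lt₀ hr
  obtain ⟨x, hx⟩ := (PadicInt.norm_lt_one_iff_dvd ⟨r⁻¹, hlt.le⟩).1 hlt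
  have hp : (p : ℚ_[p]) ≠ 0 := by exact_mod_cast (Fact.out : p.Prime).ne_zero
  have hrx : r * x = (p : ℚ_[p])⁻¹ := by
    have hx : r⁻¹ = p * (x : ℚ_[p]) := congrArg ((↑) : ℤ_[p] → ℚ_[p]) hx
    field_simp at hx ⊢
    linear_combination -hx
  exact ⟨x, by rw [padicIntChar_apply, hrx]; exact padicChar_inv_p_ne_one⟩

theorem continuous_padicIntChar (r : ℚ_[p]) : Continuous (padicIntChar p r) := by
  refine IsLocallyConstant.continuous ((IsLocallyConstant.iff_eventually_eq _).2 fun x => ?_)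
  have hcont : Continuous fun y : ℤ_[p] => ‖r * ((y - x : ℤ_[p]) : ℚ_[p])‖ := by fun_prop
  have hnear := hcont.continuousAt.eventually_lt (x₀ := x) (g := fun _ => 1)
    continuousAt_const (by simp)
  filter_upwards [hnear] with y hy
  rw [← sub_add_cancel y x, AddChar.map_add_eq_mul, padicIntChar_apply,
    padicChar_eq_one hy.le, one_mul]

theorem forall_mem_padicIntCharGroup {P : AddChar ℤ_[p] Circle → Prop} :
    (∀ χ ∈ padicIntCharGroup p, P χ) ↔ ∀ r, P (padicIntChar p r) :=
  Set.forall_mem_range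

theorem isSeparatingCharGroup_padicIntCharGroup : IsSeparatingCharGroup (padicIntCharGroup p) where
  continuous := forall_mem_padicIntCharGroup.2 continuous_padicIntChar
  exists_ne_one x hx := by
    refine ⟨padicIntChar p (p * x)⁻¹, ⟨_, rfl⟩, ?_⟩
    replace hx : (x : ℚ_[p]) ≠ 0 := fun h => hx (PadicInt.ext h)
    rw [padicIntChar_apply, mul_inv, inv_mul_cancel_right₀ hx]
    exact padicChar_inv_p_ne_one

theorem padicIntChar_compAddMonoidHom_mulLeft (r : ℚ_[p]) (c : ℤ_[p]) :
    (padicIntChar p r).compAddMonoidHom (AddMonoidHom.mulLeft c) = padicIntChar p (c * r) := by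
  ext x
  simp only [AddChar.compAddMonoidHom_apply, padicIntChar_apply, AddMonoidHom.coe_mulLeft,
    PadicInt.coe_mul]
  ring_nf

variable [MeasurableSpace ℤ_[p]] {μ : Measure ℤ_[p]} {r s : ℚ_[p]}

/-- The characteristic function of a distribution on `ℤ_p`, as a function on `ℚ_p`. -/
noncomputable def padicCharFun (μ : Measure ℤ_[p]) (r : ℚ_[p]) : ℂ :=
  addCharFun μ (padicIntChar p r)

theorem padicCharFun_congr (μ : Measure ℤ_[p]) (h : ‖r - s‖ ≤ 1) :
    padicCharFun μ r = padicCharFun μ s := by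
  rw [padicCharFun, padicCharFun, ← sub_add_cancel r s, AddChar.map_add_eq_mul,
    padicIntChar_eq_one h, one_mul]

theorem norm_padicCharFun_neg (μ : Measure ℤ_[p]) (r : ℚ_[p]) :
    ‖padicCharFun μ (-r)‖ = ‖padicCharFun μ r‖ := by
  rw [padicCharFun, AddChar.map_neg_eq_inv, addCharFun_inv, norm_star, padicCharFun]

variable [IsProbabilityMeasure μ]

theorem norm_padicCharFun_le_one (r : ℚ_[p]) : ‖padicCharFun μ r‖ ≤ 1 :=
  norm_addCharFun_le_one _

theorem padicCharFun_eq_one (hr : ‖r‖ ≤ 1) : padicCharFun μ r = 1 :=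
  addCharFun_eq_of_ae_eq (.of_forall fun x => by simp [padicIntChar_eq_one hr])

theorem norm_padicCharFun_mul_eq_one (hr : ‖padicCharFun μ r‖ = 1) (hs : ‖s‖ ≤ 1) :
    ‖padicCharFun μ (s * r)‖ = 1 := by
  have hopen : IsOpen {t : ℤ_[p] | ‖(s - t) * r‖ < 1} :=
    isOpen_lt (by fun_prop) continuous_const
  obtain ⟨m, hm⟩ := PadicInt.denseRange_natCast.exists_mem_open hopen
    ⟨⟨s, hs⟩, show ‖(s - s) * r‖ < 1 by simp⟩
  have hsr : ‖s * r - m • r‖ ≤ 1 := by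
    rw [nsmul_eq_mul, ← sub_mul]
    exact hm.le
  rw [padicCharFun_congr μ hsr, padicCharFun, AddChar.map_nsmul_eq_pow]
  exact norm_addCharFun_pow_eq_one hr m

end PadicChar

section HeydeEquation

/-- Heyde's functional equation with parameter `c` for functions `f` and `g`: when `f` and `g` are
the characteristic functions of independent `ξ₁` and `ξ₂`, it says that the conditional
distribution of `ξ₁ + c ξ₂` given `ξ₁ + ξ₂` is symmetric. -/
def HeydeEquation {R : Type*} [Ring R] (f g : R → ℂ) (c : R) : Prop :=
  ∀ u v, f (u + v) * g (u + c * v) = f (u - v) * g (u - c * v)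

theorem HeydeEquation.symm {F : Type*} [Field F] {f g : F → ℂ} {c : F} (h : HeydeEquation f g c)
    (hc : c ≠ 0) : HeydeEquation g f c⁻¹ := fun u v => by
  have hv := h u (c⁻¹ * v)
  rw [mul_inv_cancel_left₀ hc] at hv
  rw [mul_comm, hv, mul_comm]

variable {p : ℕ} [Fact p.Prime]

theorem exists_pos_norm_pow_mul_sub_le_one {κ : ℚ_[p]} (hκ : ‖κ‖ = 1) (r : ℚ_[p]) :
    ∃ k > 0, ‖κ ^ k * r - r‖ ≤ 1 := by
  have hp : 1 < (p : ℝ) := by exact_mod_cast (Fact.out : p.Prime).one_lt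
  obtain ⟨n, hn⟩ := pow_unbounded_of_one_lt ‖r‖ hp
  obtain ⟨k, hk, hpow⟩ := isOfFinOrder_iff_pow_eq_one.1 <|
    isOfFinOrder_of_finite (Units.map (PadicInt.toZModPow n).toMonoidHom (PadicInt.mkUnits hκ))
  have hker : (PadicInt.mkUnits hκ : ℤ_[p]) ^ k - 1 ∈ RingHom.ker (PadicInt.toZModPow n) := by
    rw [RingHom.mem_ker, map_sub, map_pow, map_one, sub_eq_zero]
    exact congrArg Units.val hpow
  rw [PadicInt.ker_toZModPow, ← PadicInt.norm_le_pow_iff_mem_span_pow] at hker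
  refine ⟨k, hk, ?_⟩
  calc ‖κ ^ k * r - r‖ = ‖κ ^ k - 1‖ * ‖r‖ := by rw [← norm_mul, sub_one_mul]
    _ ≤ (p : ℝ) ^ (-n : ℤ) * (p : ℝ) ^ n := by gcongr; exact hker
    _ = 1 := by rw [← zpow_natCast, ← zpow_add₀ (by positivity), neg_add_cancel, zpow_zero]

theorem symmetricCondDistrib_iff_heydeEquation [MeasurableSpace ℤ_[p]] [BorelSpace ℤ_[p]]
    {Ω : Type*} [MeasurableSpace Ω] {P : Measure Ω} [IsFiniteMeasure P] {ξ₁ ξ₂ : Ω → ℤ_[p]}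
    (h₁ : Measurable ξ₁) (h₂ : Measurable ξ₂) (hind : IndepFun ξ₁ ξ₂ P) (c : ℤ_[p]) :
    SymmetricCondDistrib (fun ω => ξ₁ ω + c * ξ₂ ω) (fun ω => ξ₁ ω + ξ₂ ω) P ↔
      HeydeEquation (padicCharFun (P.map ξ₁)) (padicCharFun (P.map ξ₂)) c := by
  have hα : Continuous (AddMonoidHom.mulLeft c) := continuous_const_mul c
  refine (isSeparatingCharGroup_padicIntCharGroup.symmetricCondDistrib_iff h₁ h₂ hind hα).trans ?_
  simp only [forall_mem_padicIntCharGroup, padicIntChar_compAddMonoidHom_mulLeft,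
    ← AddChar.map_add_eq_mul, ← AddChar.map_sub_eq_div]
  rfl

variable [MeasurableSpace ℤ_[p]] {μ ν : Measure ℤ_[p]} [IsProbabilityMeasure ν] {c r : ℚ_[p]}

namespace HeydeEquation

theorem norm_padicCharFun_mul (h : HeydeEquation (padicCharFun μ) (padicCharFun ν) c)
    (hc : 1 + c ≠ 0) (r : ℚ_[p]) :
    ‖padicCharFun μ ((1 - c) / (1 + c) * r)‖ =
      ‖padicCharFun μ r‖ * ‖padicCharFun ν (2 * c / (1 + c) * r)‖ := by
  -- At `u = -c v` with `v = r / (1 + c)`, the argument `u + c v` of `ν̂` vanishes.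
  have huv := h (-c * (r / (1 + c))) (r / (1 + c))
  rw [show -c * (r / (1 + c)) + r / (1 + c) = (1 - c) / (1 + c) * r by ring,
    show -c * (r / (1 + c)) + c * (r / (1 + c)) = 0 by ring,
    show -c * (r / (1 + c)) - r / (1 + c) = -r by field_simp; ring,
    show -c * (r / (1 + c)) - c * (r / (1 + c)) = -(2 * c / (1 + c) * r) by ring,
    padicCharFun_eq_one (r := 0) (by simp), mul_one] at huv
  rw [huv, norm_mul, norm_padicCharFun_neg, norm_padicCharFun_neg]

theorem norm_padicCharFun_pow_mul_le (h : HeydeEquation (padicCharFun μ) (padicCharFun ν) c)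
    (hc : 1 + c ≠ 0) (r : ℚ_[p]) (k : ℕ) :
    ‖padicCharFun μ (((1 - c) / (1 + c)) ^ k * r)‖ ≤ ‖padicCharFun μ r‖ := by
  induction k with
  | zero => simp
  | succ k ih =>
    rw [pow_succ', mul_assoc, h.norm_padicCharFun_mul hc]
    exact (mul_le_of_le_one_right (norm_nonneg _) (norm_padicCharFun_le_one _)).trans ih

variable [IsProbabilityMeasure μ]

theorem norm_padicCharFun_eq_one (h : HeydeEquation (padicCharFun μ) (padicCharFun ν) c)
    (hc : ‖1 - c‖ < ‖1 + c‖) (r : ℚ_[p]) : ‖padicCharFun μ r‖ = 1 := by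
  have hpos : 0 < ‖1 + c‖ := (norm_nonneg _).trans_lt hc
  have hlt : ‖(1 - c) / (1 + c)‖ < 1 := by rwa [norm_div, div_lt_one hpos]
  have hlim := (tendsto_pow_atTop_nhds_zero_of_norm_lt_one hlt).mul_const r
  rw [zero_mul] at hlim
  obtain ⟨k, hk⟩ := (hlim.norm.eventually_lt_const (u := 1) (by simp)).exists
  refine le_antisymm (norm_padicCharFun_le_one r) ?_
  calc 1 = ‖padicCharFun μ (((1 - c) / (1 + c)) ^ k * r)‖ := by
        rw [padicCharFun_eq_one hk.le, norm_one]
    _ ≤ ‖padicCharFun μ r‖ := h.norm_padicCharFun_pow_mul_le (norm_pos_iff.1 hpos) r k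

theorem norm_padicCharFun_right_eq_one
    (h : HeydeEquation (padicCharFun μ) (padicCharFun ν) c) (hc : ‖1 - c‖ < ‖1 + c‖)
    (r : ℚ_[p]) : ‖padicCharFun ν r‖ = 1 := by
  have hc₀ : c ≠ 0 := by
    rintro rfl
    simp at hc
  refine (h.symm hc₀).norm_padicCharFun_eq_one ?_ r
  have hsub : 1 - c⁻¹ = -(1 - c) * c⁻¹ := by field_simp; ring
  have hadd : 1 + c⁻¹ = (1 + c) * c⁻¹ := by field_simp; ring
  rw [hsub, hadd, norm_mul, norm_mul, norm_neg]
  exact mul_lt_mul_of_pos_right hc (norm_pos_iff.2 (inv_ne_zero hc₀))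

theorem norm_padicCharFun_right_eq_one_of_ne_zero
    (h : HeydeEquation (padicCharFun μ) (padicCharFun ν) c) (h2 : ‖(2 : ℚ_[p])‖ = 1)
    (hc : ‖c‖ = 1) (hc' : ‖1 + c‖ = 1) (hr : padicCharFun μ r ≠ 0) :
    ‖padicCharFun ν r‖ = 1 := by
  have hc₁ : 1 + c ≠ 0 := norm_ne_zero_iff.1 (hc' ▸ one_ne_zero)
  have hle : ‖1 - c‖ ≤ 1 := by
    simpa [← sub_eq_add_neg, hc] using Padic.nonarchimedean 1 (-c)
  rcases hle.lt_or_eq with hlt | heq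
  · exact h.norm_padicCharFun_right_eq_one (hc'.symm ▸ hlt) r
  set κ := (1 - c) / (1 + c) with hκ
  set s := 2 * c / (1 + c) with hs
  have hsnorm : ‖s‖ = 1 := by simp [hs, h2, hc, hc']
  have hsr : ‖padicCharFun ν (s * r)‖ = 1 := by
    refine le_antisymm (norm_padicCharFun_le_one _) ?_
    obtain ⟨k, hk, hkr⟩ := exists_pos_norm_pow_mul_sub_le_one (κ := κ)
      (by simp [hκ, heq, hc']) r
    obtain ⟨k, rfl⟩ := Nat.exists_eq_add_one_of_ne_zero hk.ne'
    refine le_of_mul_le_mul_left ?_ (norm_pos_iff.2 hr)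
    calc ‖padicCharFun μ r‖ * 1 = ‖padicCharFun μ (κ ^ k * (κ * r))‖ := by
          rw [mul_one, ← mul_assoc, ← pow_succ, padicCharFun_congr μ hkr]
      _ ≤ ‖padicCharFun μ (κ * r)‖ := h.norm_padicCharFun_pow_mul_le hc₁ _ k
      _ = ‖padicCharFun μ r‖ * ‖padicCharFun ν (s * r)‖ := h.norm_padicCharFun_mul hc₁ r
  have := norm_padicCharFun_mul_eq_one hsr (s := s⁻¹) (by simp [hsnorm])
  rwa [inv_mul_cancel_left₀ (norm_ne_zero_iff.1 (hsnorm ▸ one_ne_zero))] at this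

variable [BorelSpace ℤ_[p]]

theorem isDegenerateDistribution (h : HeydeEquation (padicCharFun μ) (padicCharFun ν) c)
    (hc : ‖1 - c‖ < ‖1 + c‖) :
    IsDegenerateDistribution μ ∧ IsDegenerateDistribution ν :=
  ⟨isSeparatingCharGroup_padicIntCharGroup.isDegenerateDistribution
    (forall_mem_padicIntCharGroup.2 (h.norm_padicCharFun_eq_one hc)),
  isSeparatingCharGroup_padicIntCharGroup.isDegenerateDistribution
    (forall_mem_padicIntCharGroup.2 (h.norm_padicCharFun_right_eq_one hc))⟩

theorem exists_haarDistribution (h : HeydeEquation (padicCharFun μ) (padicCharFun ν) c)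
    (h2 : ‖(2 : ℚ_[p])‖ = 1) (hc : ‖c‖ = 1) (hc' : ‖1 + c‖ = 1) :
    ∃ (K : AddSubgroup ℤ_[p]) (_ : CompactSpace K) (x₁ x₂ : ℤ_[p]),
      μ = haarDistribution K ∗ Measure.dirac x₁ ∧ ν = haarDistribution K ∗ Measure.dirac x₂ := by
  have hc₀ : c ≠ 0 := norm_ne_zero_iff.1 (hc ▸ one_ne_zero)
  have hinv : ‖1 + c⁻¹‖ = 1 := by
    rw [show 1 + c⁻¹ = (1 + c) * c⁻¹ by field_simp; ring, norm_mul, norm_inv, hc, hc']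
    norm_num
  exact isSeparatingCharGroup_padicIntCharGroup.exists_haarDistribution_of_norm_eq_one
    (forall_mem_padicIntCharGroup.2 fun _ =>
      h.norm_padicCharFun_right_eq_one_of_ne_zero h2 hc hc')
    (forall_mem_padicIntCharGroup.2 fun _ =>
      (h.symm hc₀).norm_padicCharFun_right_eq_one_of_ne_zero h2 (by simp [hc]) hinv)

end HeydeEquation

end HeydeEquation

section HaarMixture

variable {p : ℕ} [Fact p.Prime] {c r : ℚ_[p]}

theorem heydeEquation_of_norm_add_lt_norm_sub {f : ℚ_[p] → ℂ}
    (hf : ∀ r s, ‖r - s‖ ≤ 1 → f r = f s) (hsupp : ∀ r, p < ‖r‖ → f r = 0)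
    (hc : ‖1 + c‖ < ‖1 - c‖) : HeydeEquation f f c := by
  intro u v
  have hzero {r s} (hrs : p < ‖r - s‖) : f r * f s = 0 := by
    rcases lt_max_iff.1 (hrs.trans_le (sub_eq_add_neg r s ▸ Padic.nonarchimedean r (-s)))
      with hr | hs
    · rw [hsupp r hr, zero_mul]
    · rw [hsupp s (norm_neg s ▸ hs), mul_zero]
  rcases lt_or_ge (p : ℝ) ‖(1 - c) * v‖ with hlt | hle
  · rw [hzero, hzero]
    · rwa [← norm_neg, show -(u - v - (u - c * v)) = (1 - c) * v by ring]
    · rwa [show u + v - (u + c * v) = (1 - c) * v by ring]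
  -- A small `(1 - c) v` forces `(1 + c) v ∈ ℤ_p`, and then the two factors are interchanged.
  · have hv : ‖(1 + c) * v‖ ≤ 1 := by
      rcases eq_or_ne v 0 with rfl | hv
      · simp
      · have hlt : ‖(1 + c) * v‖ < p := by
          refine lt_of_lt_of_le ?_ hle
          rw [norm_mul, norm_mul]
          exact mul_lt_mul_of_pos_right hc (norm_pos_iff.2 hv)
        have hiff := Padic.norm_le_pow_iff_norm_lt_pow_add_one ((1 + c) * v) 0
        rw [zpow_zero, zero_add, zpow_one] at hiff
        exact hiff.2 hlt
    rw [hf (u + v) (u - c * v) (by rwa [show u + v - (u - c * v) = (1 + c) * v by ring]),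
      hf (u + c * v) (u - v) (by rwa [show u + c * v - (u - v) = (1 + c) * v by ring]), mul_comm]

instance compactSpace_range_mulLeft (a : ℤ_[p]) : CompactSpace (AddMonoidHom.mulLeft a).range :=
  isCompact_iff_compactSpace.1 (isCompact_range (continuous_const_mul a))

variable [MeasurableSpace ℤ_[p]] [BorelSpace ℤ_[p]] {a : ℤ_[p]}

theorem padicCharFun_haarDistribution_eq_one (h : ‖a * r‖ ≤ 1) :
    padicCharFun (haarDistribution (AddMonoidHom.mulLeft a).range) r = 1 := by
  refine addCharFun_haarDistribution_eq_one _ (continuous_padicIntChar r) ?_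
  rintro _ ⟨x, rfl⟩
  rw [← AddChar.compAddMonoidHom_apply, padicIntChar_compAddMonoidHom_mulLeft,
    padicIntChar_eq_one h, AddChar.one_apply]

theorem padicCharFun_haarDistribution_eq_zero (h : 1 < ‖a * r‖) :
    padicCharFun (haarDistribution (AddMonoidHom.mulLeft a).range) r = 0 := by
  refine addCharFun_haarDistribution_eq_zero _ (continuous_padicIntChar r) ?_
  obtain ⟨x, hx⟩ := exists_padicIntChar_ne_one h
  refine ⟨a * x, ⟨x, rfl⟩, ?_⟩
  rwa [← padicIntChar_compAddMonoidHom_mulLeft] at hx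

variable (p) in
/-- The half-sum of the Haar distributions of `ℤ_p` and `p ℤ_p`. It is not idempotent, and a pair
of independent random variables with this distribution is the counterexample to Heyde's
characterization. -/
noncomputable def haarMixture : Measure ℤ_[p] :=
  (2⁻¹ : ENNReal) • (haarDistribution (AddMonoidHom.mulLeft (1 : ℤ_[p])).range +
    haarDistribution (AddMonoidHom.mulLeft (p : ℤ_[p])).range)

instance isProbabilityMeasure_haarMixture : IsProbabilityMeasure (haarMixture p) where
  measure_univ := by
    simp [haarMixture, ENNReal.inv_two_add_inv_two]

theorem padicCharFun_haarMixture (r : ℚ_[p]) :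
    padicCharFun (haarMixture p) r =
      2⁻¹ * (padicCharFun (haarDistribution (AddMonoidHom.mulLeft (1 : ℤ_[p])).range) r +
        padicCharFun (haarDistribution (AddMonoidHom.mulLeft (p : ℤ_[p])).range) r) := by
  have hint (μ : Measure ℤ_[p]) [IsFiniteMeasure μ] :
      Integrable (fun x => (padicIntChar p r x : ℂ)) μ :=
    .of_bound (continuous_coe_addChar (continuous_padicIntChar r)).aestronglyMeasurable 1
      (.of_forall fun x => (Circle.norm_coe _).le)
  rw [padicCharFun, addCharFun, haarMixture, integral_smul_measure,
    integral_add_measure (hint _) (hint _)]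
  simp [padicCharFun, addCharFun, mul_add]

theorem heydeEquation_haarMixture (hc : ‖1 + c‖ < ‖1 - c‖) :
    HeydeEquation (padicCharFun (haarMixture p)) (padicCharFun (haarMixture p)) c := by
  refine heydeEquation_of_norm_add_lt_norm_sub (fun r s h => padicCharFun_congr _ h) ?_ hc
  intro r hr
  have hp : 1 < (p : ℝ) := by exact_mod_cast (Fact.out : p.Prime).one_lt
  have hone : 1 < ‖((1 : ℤ_[p]) : ℚ_[p]) * r‖ := by simpa using hp.trans hr
  have hpr : 1 < ‖((p : ℤ_[p]) : ℚ_[p]) * r‖ := by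
    rw [norm_mul, PadicInt.coe_natCast, Padic.norm_p, ← div_eq_inv_mul]
    exact (one_lt_div (one_pos.trans hp)).2 hr
  rw [padicCharFun_haarMixture, padicCharFun_haarDistribution_eq_zero hone,
    padicCharFun_haarDistribution_eq_zero hpr, add_zero, mul_zero]

theorem not_isIdempotentDistribution_haarMixture : ¬ IsIdempotentDistribution (haarMixture p) := by
  have hp : 1 < (p : ℝ) := by exact_mod_cast (Fact.out : p.Prime).one_lt
  have hhalf : padicCharFun (haarMixture p) (p : ℚ_[p])⁻¹ = 2⁻¹ := by
    rw [padicCharFun_haarMixture, padicCharFun_haarDistribution_eq_zero,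
      padicCharFun_haarDistribution_eq_one]
    · simp
    · simp
    · simpa using hp
  intro h
  have := h.addCharFun_eq_zero_or_norm_eq_one (continuous_padicIntChar (p : ℚ_[p])⁻¹)
  rw [← padicCharFun, hhalf] at this
  norm_num at this

end HaarMixture

section Digits

theorem norm_lt_norm_of_norm_lt_norm_add {S : Type*} [SeminormedAddGroup S] [IsUltrametricDist S]
    {y z : S} (h : ‖y‖ < ‖y + z‖) : ‖y‖ < ‖z‖ :=
  (lt_max_iff.1 (h.trans_le (IsUltrametricDist.norm_add_le_max y z))).resolve_left (lt_irrefl _)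

variable {p : ℕ} [Fact p.Prime]

theorem sum_padicDigit_mul_pow (x : ℤ_[p]) (n : ℕ) :
    ∑ i ∈ Finset.range n, padicDigit x i * p ^ i = (PadicInt.toZModPow n x).val := by
  induction n with
  | zero =>
    have hlt : (PadicInt.toZModPow 0 x).val < 1 := ZMod.val_lt _
    rw [Finset.sum_range_zero, Nat.lt_one_iff.1 hlt]
  | succ n ih =>
    have hmod : (PadicInt.toZModPow n x).val = (PadicInt.toZModPow (n + 1) x).val % p ^ n := by
      rw [← PadicInt.cast_toZModPow n (n + 1) n.le_succ x, ZMod.cast_eq_val, ZMod.val_natCast]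
    rw [Finset.sum_range_succ, ih, hmod, padicDigit, mul_comm, Nat.mod_add_div]

theorem norm_sub_sum_padicDigit_le (x : ℤ_[p]) (n : ℕ) :
    ‖x - ∑ i ∈ Finset.range n, (padicDigit x i : ℤ_[p]) * (p : ℤ_[p]) ^ i‖ ≤
      (p : ℝ) ^ (-n : ℤ) := by
  have hsum : ∑ i ∈ Finset.range n, (padicDigit x i : ℤ_[p]) * (p : ℤ_[p]) ^ i =
      ((PadicInt.toZModPow n x).val : ℤ_[p]) := by
    exact_mod_cast congrArg ((↑) : ℕ → ℤ_[p]) (sum_padicDigit_mul_pow x n)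
  rw [hsum, PadicInt.norm_le_pow_iff_mem_span_pow, ← PadicInt.ker_toZModPow, RingHom.mem_ker]
  simp

theorem padicDigit_lt (x : ℤ_[p]) (n : ℕ) : padicDigit x n < p :=
  Nat.div_lt_of_lt_mul <| by simpa [pow_succ] using ZMod.val_lt (PadicInt.toZModPow (n + 1) x)

theorem norm_sub_padicDigit_zero_lt_one (x : ℤ_[p]) : ‖x - padicDigit x 0‖ < 1 := by
  have hp : 1 < (p : ℝ) := by exact_mod_cast (Fact.out : p.Prime).one_lt
  refine (by simpa using norm_sub_sum_padicDigit_le x 1 : _ ≤ (p : ℝ)⁻¹).trans_lt ?_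
  exact inv_lt_one_of_one_lt₀ hp

theorem norm_two_lt_one : ‖(2 : ℤ_[2])‖ < 1 :=
  PadicInt.norm_natCast_lt_one_iff.2 dvd_rfl

theorem norm_sub_padicDigit_add_two_mul_padicDigit_lt_norm_two {x : ℤ_[2]} :
    ‖x - (padicDigit x 0 + padicDigit x 1 * 2)‖ < ‖(2 : ℤ_[2])‖ := by
  have h2 : ‖(2 : ℤ_[2])‖ = 2⁻¹ := by exact_mod_cast PadicInt.norm_p (p := 2)
  have h := norm_sub_sum_padicDigit_le x 2
  simp only [Finset.sum_range_succ, Finset.sum_range_zero, zero_add, pow_zero, mul_one, pow_one,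
    Nat.cast_ofNat] at h
  refine h.trans_lt ?_
  rw [h2]
  norm_num

theorem norm_two_eq_one (hp : 2 < p) : ‖(2 : ℤ_[p])‖ = 1 := by
  refine (PadicInt.norm_le_one 2).eq_of_not_lt fun h => ?_
  have hdvd : p ∣ 2 := PadicInt.norm_natCast_lt_one_iff.1 (by exact_mod_cast h)
  exact hp.not_ge (Nat.le_of_dvd two_pos hdvd)

variable {x : ℤ_[p]}

theorem norm_one_add_eq_one_of_padicDigit_ne (h : padicDigit x 0 ≠ p - 1) : ‖1 + x‖ = 1 := by
  refine (PadicInt.norm_le_one _).eq_of_not_lt fun hlt => h ?_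
  have hdigit : ‖((padicDigit x 0 + 1 : ℕ) : ℤ_[p])‖ < 1 := by
    rw [show ((padicDigit x 0 + 1 : ℕ) : ℤ_[p]) = 1 + x + -(x - padicDigit x 0) by push_cast; ring]
    refine (PadicInt.nonarchimedean _ _).trans_lt (max_lt hlt ?_)
    rw [norm_neg]
    exact norm_sub_padicDigit_zero_lt_one x
  have hdvd := PadicInt.norm_natCast_lt_one_iff.1 hdigit
  have := Nat.le_of_dvd (Nat.succ_pos _) hdvd
  have := padicDigit_lt x 0
  omega

theorem norm_one_sub_lt_norm_one_add (h : 2 < p ∧ padicDigit x 0 = 1 ∨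
    p = 2 ∧ padicDigit x 0 = 1 ∧ padicDigit x 1 = 0) : ‖1 - x‖ < ‖1 + x‖ := by
  refine norm_lt_norm_of_norm_lt_norm_add ?_
  rw [show 1 - x + (1 + x) = 2 by ring, ← norm_sub_rev]
  rcases h with ⟨hp, h0⟩ | ⟨rfl, h0, h1⟩
  · rw [norm_two_eq_one hp]
    simpa [h0] using norm_sub_padicDigit_zero_lt_one x
  · simpa [h0, h1] using norm_sub_padicDigit_add_two_mul_padicDigit_lt_norm_two (x := x)

theorem norm_one_add_lt_norm_one_sub (h : 2 < p ∧ padicDigit x 0 = p - 1 ∨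
    p = 2 ∧ padicDigit x 0 = 1 ∧ padicDigit x 1 = 1) : ‖1 + x‖ < ‖1 - x‖ := by
  refine norm_lt_norm_of_norm_lt_norm_add ?_
  rw [show 1 + x + (1 - x) = 2 by ring]
  rcases h with ⟨hp, h0⟩ | ⟨rfl, h0, h1⟩
  · have hlt := norm_sub_padicDigit_zero_lt_one x
    rw [h0, Nat.cast_sub (Fact.out : p.Prime).one_le] at hlt
    rw [norm_two_eq_one hp, show 1 + x = x - (p - 1) + p by ring]
    refine (PadicInt.nonarchimedean _ _).trans_lt (max_lt (by exact_mod_cast hlt) ?_)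
    exact PadicInt.norm_natCast_lt_one_iff.2 dvd_rfl
  · have hlt := norm_sub_padicDigit_add_two_mul_padicDigit_lt_norm_two (x := x)
    rw [h0, h1] at hlt
    rw [show 1 + x = x - (1 + 1 * 2) + 2 * 2 by ring]
    refine (PadicInt.nonarchimedean _ _).trans_lt (max_lt (by exact_mod_cast hlt) ?_)
    rw [norm_mul]
    exact mul_lt_of_lt_one_left (norm_pos_iff.2 two_ne_zero) norm_two_lt_one

end Digits

theorem theorem2 (p : ℕ) [Fact p.Prime] [MeasurableSpace ℤ_[p]] [BorelSpace ℤ_[p]]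
    (α : ℤ_[p] ≃ₜ+ ℤ_[p]) (c : ℤ_[p]ˣ) (hα : ∀ x, α x = c * x) :
    -- Statement 1
    (∀ (Ω : Type*) [MeasurableSpace Ω] (P : Measure Ω) [IsProbabilityMeasure P]
        (ξ₁ ξ₂ : Ω → ℤ_[p]) (μ₁ μ₂ : Measure ℤ_[p]),
        Measurable ξ₁ → Measurable ξ₂ → IndepFun ξ₁ ξ₂ P →
        P.map ξ₁ = μ₁ → P.map ξ₂ = μ₂ →
        SymmetricCondDistrib (fun ω => ξ₁ ω + α (ξ₂ ω)) (fun ω => ξ₁ ω + ξ₂ ω) P →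
        -- 1(i)
        (2 < p → padicDigit (c : ℤ_[p]) 0 ≠ p - 1 →
          (∃ (K : AddSubgroup ℤ_[p]) (_ : CompactSpace K) (x₁ x₂ : ℤ_[p]),
            μ₁ = haarDistribution K ∗ Measure.dirac x₁ ∧
            μ₂ = haarDistribution K ∗ Measure.dirac x₂) ∧
          (padicDigit (c : ℤ_[p]) 0 = 1 →
            IsDegenerateDistribution μ₁ ∧ IsDegenerateDistribution μ₂)) ∧
        -- 1(ii)
        (p = 2 → padicDigit (c : ℤ_[p]) 0 = 1 → padicDigit (c : ℤ_[p]) 1 = 0 →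
          IsDegenerateDistribution μ₁ ∧ IsDegenerateDistribution μ₂)) ∧
    -- Statement 2
    ((2 < p ∧ padicDigit (c : ℤ_[p]) 0 = p - 1) ∨
        (p = 2 ∧ padicDigit (c : ℤ_[p]) 0 = 1 ∧ padicDigit (c : ℤ_[p]) 1 = 1) →
      ∃ (Ω : Type) (_ : MeasurableSpace Ω) (P : Measure Ω) (_ : IsProbabilityMeasure P)
        (ξ₁ ξ₂ : Ω → ℤ_[p]) (μ₁ μ₂ : Measure ℤ_[p]),
        Measurable ξ₁ ∧ Measurable ξ₂ ∧ IndepFun ξ₁ ξ₂ P ∧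
        P.map ξ₁ = μ₁ ∧ P.map ξ₂ = μ₂ ∧
        SymmetricCondDistrib (fun ω => ξ₁ ω + α (ξ₂ ω)) (fun ω => ξ₁ ω + ξ₂ ω) P ∧
        ¬ IsIdempotentDistribution μ₁ ∧ ¬ IsIdempotentDistribution μ₂) := by
  have hc : ‖((c : ℤ_[p]) : ℚ_[p])‖ = 1 := PadicInt.norm_units c
  simp only [hα]
  refine ⟨?_, fun hdigits => ?_⟩
  · rintro Ω _ P _ ξ₁ ξ₂ _ _ h₁ h₂ hind rfl rfl hsymm
    have := Measure.isProbabilityMeasure_map (μ := P) h₁.aemeasurable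
    have := Measure.isProbabilityMeasure_map (μ := P) h₂.aemeasurable
    have heyde := (symmetricCondDistrib_iff_heydeEquation h₁ h₂ hind c).1 hsymm
    refine ⟨fun hp hp₁ => ⟨?_, fun h0 => ?_⟩, fun hp h0 h1 => ?_⟩
    · exact heyde.exists_haarDistribution (norm_two_eq_one hp) hc
        (norm_one_add_eq_one_of_padicDigit_ne hp₁)
    · exact heyde.isDegenerateDistribution (norm_one_sub_lt_norm_one_add (.inl ⟨hp, h0⟩))
    · exact heyde.isDegenerateDistribution (norm_one_sub_lt_norm_one_add (.inr ⟨hp, h0, h1⟩))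
  · have heyde := heydeEquation_haarMixture (norm_one_add_lt_norm_one_sub hdigits)
    have hind : IndepFun Prod.fst Prod.snd ((haarMixture p).prod (haarMixture p)) :=
      indepFun_prod measurable_id measurable_id
    have hsymm := (symmetricCondDistrib_iff_heydeEquation measurable_fst measurable_snd hind c).2
      (by simpa using heyde)
    exact ⟨ℤ_[p] × ℤ_[p], _, _, inferInstance, Prod.fst, Prod.snd, _, _, measurable_fst,
      measurable_snd, hind, by simp, by simp, hsymm,
      not_isIdempotentDistribution_haarMixture, not_isIdempotentDistribution_haarMixture⟩
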